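/- All graphs are finite, simple and undirected with nonempty vertex set. In a graph whose vertices are filled or unfilled, a filled vertex $u$ may change an unfilled vertex $w$ to filled if $w$ is the only unfilled neighbor of $u$. A set $S$ of vertices is a zero forcing set if, starting with exactly the vertices of $S$ filled, repeated application of this rule fills all vertices; $Z(G)$ is the minimum cardinality of a zero forcing set of $G$. The Cartesian product is denoted by $\Box$. A star is a graph $K_{1,s}$ with $s\ge 1$, and a clique is a complete graph $K_m$ with $m\ge 1$. A star-clique path is a graph $G=\bigcup_{i=1}^k G_i'$ with $k\ge 1$, where each subgraph $G_i'$ is a star or a clique, such that: 1. for each $i\in\{2,\dots,k\}$, $V(G_{i-1}')\cap V(G_i')=\{v_i\}$ for some vertex $v_i$, and $V(G_j')\cap V(G_i')=\emptyset$ for $j=1,\dots,i-2$; 2. $v_i\notin\{v_2,\dots,v_{i-1}\}$ for $i\in\{3,\dots,k\}$; 3. if $G_i'$ is a star for some $i\in\{2,\dots,k-1\}$, then $\deg_{G_i'}(v_i)=1$ and $\deg_{G_i'}(v_{i+1})=1$; 4. if $k\ge 2$ and $G_1'$ is a star, then $\deg_{G_1'}(v_2)=1$; if $k\ge 2$ and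 $G_k'$ is a star, then $\deg_{G_k'}(v_k)=1$. Theorem. Let $G$ be a star-clique path that contains an edge, and let $r\ge 2$. Then $$Z(K_r\Box G)=(r-1)Z(G)+1,$$ and this is also equal to $Z(K_r)Z(G)+1$. -/

import Mathlib

open SimpleGraph

/-- One application of the standard color change rule: with `S` the set of filled vertices,
a filled vertex `u` forces an unfilled vertex `w` which is the only unfilled neighbor of `u`,
and `T` is the new set of filled vertices. -/
def ForceStep {V : Type*} (G : SimpleGraph V) (S T : Set V) : Prop :=
  ∃ u ∈ S, ∃ w ∉ S, G.Adj u w ∧ (∀ x, G.Adj u x → x ∉ S → x = w) ∧ T = insert w S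

/-- `S` is a zero forcing set if some sequence of forces starting from `S` fills all vertices. -/
def IsZeroForcingSet {V : Type*} (G : SimpleGraph V) (S : Set V) : Prop :=
  Relation.ReflTransGen (ForceStep G) S Set.univ

/-- The zero forcing number `Z(G)` of a finite graph: the minimum cardinality of a zero forcing
set (the set of all vertices is always one). -/
noncomputable def zeroForcingNumber {V : Type*} [Fintype V] (G : SimpleGraph V) : ℕ :=
  sInf {n | ∃ S : Finset V, S.card = n ∧ IsZeroForcingSet G (S : Set V)}

/-- The graph `G` is a clique `K_m` with `m ≥ 1`. -/
def IsCliqueGraph {W : Type*} (G : SimpleGraph W) : Prop :=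
  Nonempty W ∧ G = ⊤

/-- The graph `G` is a star `K_{1,s}` with `s ≥ 1`: there is a center `c` and at least one other
vertex, and the edges are exactly the pairs consisting of `c` and another vertex. -/
def IsStarGraph {W : Type*} (G : SimpleGraph W) : Prop :=
  Nontrivial W ∧ ∃ c : W, G = starGraph c

/-- The degree of `v` in the subgraph `H` is one. -/
def HasDegreeOne {V : Type*} {G : SimpleGraph V} (H : G.Subgraph) (v : V) : Prop :=
  (H.neighborSet v).ncard = 1

/-- `G` is a star-clique path constructed from the pieces `H 1, …, H k`, where `v i` (for
`2 ≤ i ≤ k`) is the vertex shared by `H (i - 1)` and `H i`.  The values of `H` outside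
`{1, …, k}` and of `v` outside `{2, …, k}` play no role. -/
structure IsStarCliquePathOf {V : Type*} (G : SimpleGraph V) (k : ℕ) (H : ℕ → G.Subgraph)
    (v : ℕ → V) : Prop where
  one_le : 1 ≤ k
  union_eq : (⨆ i ∈ Set.Icc 1 k, H i) = ⊤
  star_or_clique : ∀ i, 1 ≤ i → i ≤ k → IsStarGraph (H i).coe ∨ IsCliqueGraph (H i).coe
  inter_consecutive : ∀ i, 2 ≤ i → i ≤ k → (H (i - 1)).verts ∩ (H i).verts = {v i}
  inter_far : ∀ i j, i ≤ k → 1 ≤ j → j + 2 ≤ i → (H j).verts ∩ (H i).verts = ∅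
  cut_ne : ∀ i j, i ≤ k → 2 ≤ j → j < i → v i ≠ v j
  star_middle : ∀ i, 2 ≤ i → i + 1 ≤ k → IsStarGraph (H i).coe →
    HasDegreeOne (H i) (v i) ∧ HasDegreeOne (H i) (v (i + 1))
  star_first : 2 ≤ k → IsStarGraph (H 1).coe → HasDegreeOne (H 1) (v 2)
  star_last : 2 ≤ k → IsStarGraph (H k).coe → HasDegreeOne (H k) (v k)

/-- `G` is a star-clique path. -/
def IsStarCliquePath {V : Type*} (G : SimpleGraph V) : Prop :=
  ∃ (k : ℕ) (H : ℕ → G.Subgraph) (v : ℕ → V), IsStarCliquePathOf G k H v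

/-! Upper bounds come from explicit forcing sets, lower bounds from nullity: if a real matrix has
off-diagonal pattern `G`, its nullity is at most `Z(G)`.

Each piece `P i` carries a symmetric nonnegative matrix `A i` of rank at most 0, 1 or 2 (single
vertex, clique, star with at least two leaves) and a set `S i` with `rank + |S i| + 1 ≤ |P i|` that
fills the piece once its entry vertex is filled. Write `N = ∑ |S i|`. Filling the pieces in order
gives `Z(G) ≤ N + 1`. The sum `B` of the `A i` has pattern `G`, and rank subadditivity, with pieces
glued along single vertices, gives nullity at least `N + 1`. So both equal `N + 1`.

In the product, all `r` copies of the first entry vertex and `r - 1` copies of each `S i` suffice: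
`r + (r - 1) N = (r - 1)(N + 1) + 1`. Conversely (`mul_finrank_ker_add_one_le`), for a suitable `t ≠
0` the matrix `t J ⊗ I + I ⊗ B` is annihilated by families of `r` vectors of `ker B` with sum zero,
and by one more vector: a constant family of eigenvectors of `B` with nonzero eigenvalue. -/

/-! ### Zero forcing through closed sets -/

/-- A set of vertices is forcing closed if no filled vertex of it can force a new vertex. -/
def IsForcingClosed {V : Type*} (G : SimpleGraph V) (T : Set V) : Prop :=
  ∀ u ∈ T, ∀ w, G.Adj u w → (∀ x, G.Adj u x → x ≠ w → x ∈ T) → w ∈ T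

/-- A forcing sequence started inside a closed set never leaves it. With the converse below, this
replaces sequences of forces by closed supersets. -/
theorem IsZeroForcingSet.eq_univ_of_subset {V : Type*} {G : SimpleGraph V} {S T : Set V}
    (hS : IsZeroForcingSet G S) (hST : S ⊆ T) (hT : IsForcingClosed G T) : T = Set.univ := by
  have key : Set.univ ⊆ T := by
    unfold IsZeroForcingSet at hS
    generalize Set.univ = U at hS
    induction hS with
    | refl => exact hST
    | tail _ h ih =>
      obtain ⟨u, hu, w, hw, huw, hx, rfl⟩ := h
      refine Set.insert_subset (hT u (ih hu) w huw fun x hux hxw => ?_) ih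
      by_contra hxT
      exact hxw (hx x hux fun h => hxT (ih h))
  exact Set.univ_subset_iff.mp key

theorem isZeroForcingSet_of_forall_closed {V : Type*} [Finite V] {G : SimpleGraph V} (S : Set V)
    (hS : ∀ T, S ⊆ T → IsForcingClosed G T → T = Set.univ) : IsZeroForcingSet G S := by
  induction S using WellFoundedGT.induction with
  | ind S ih =>
    by_cases hc : IsForcingClosed G S
    · rw [hS S subset_rfl hc]
      exact Relation.ReflTransGen.refl
    · unfold IsForcingClosed at hc
      push Not at hc
      obtain ⟨u, hu, w, huw, hx, hw⟩ := hc
      refine Relation.ReflTransGen.head (b := insert w S) ⟨u, hu, w, hw, huw, ?_, rfl⟩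
        (ih _ (Set.ssubset_insert hw) fun T hT => hS T ((Set.subset_insert _ _).trans hT))
      intro x hux hxS
      by_contra hxw
      exact hxS (hx x hux hxw)

theorem zeroForcingNumber_le {V : Type*} [Fintype V] {G : SimpleGraph V} (S : Finset V)
    (hS : ∀ T : Set V, (∀ x ∈ S, x ∈ T) → IsForcingClosed G T → T = Set.univ) :
    zeroForcingNumber G ≤ S.card :=
  Nat.sInf_le ⟨S, rfl, isZeroForcingSet_of_forall_closed _ fun T h => hS T h⟩

theorem le_zeroForcingNumber {V : Type*} [Fintype V] {G : SimpleGraph V} {n : ℕ}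
    (h : ∀ S : Finset V, IsZeroForcingSet G (S : Set V) → n ≤ S.card) :
    n ≤ zeroForcingNumber G := by
  refine le_csInf ⟨_, Finset.univ, rfl, ?_⟩ ?_
  · rw [Finset.coe_univ]
    exact Relation.ReflTransGen.refl
  · rintro _ ⟨S, rfl, hS⟩
    exact h S hS

/-! ### Nullity bounds, for a graph and for its product with a complete graph -/

/-- The zero set of a vector in the kernel of a matrix with the pattern of `G` is closed. -/
theorem isForcingClosed_zeros {W : Type*} [Fintype W] {G : SimpleGraph W} {M : Matrix W W ℝ}
    (hM : ∀ u w, u ≠ w → (M u w ≠ 0 ↔ G.Adj u w)) {x : W → ℝ} (hx : M.mulVec x = 0) :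
    IsForcingClosed G {u | x u = 0} := by
  intro u hu w huw h
  have h0 : ∑ y, M u y * x y = 0 := congrFun hx u
  rw [Finset.sum_eq_single w] at h0
  · exact (mul_eq_zero.mp h0).resolve_left ((hM u w huw.ne).mpr huw)
  · intro y _ hyw
    by_cases hyu : u = y
    · subst hyu
      rw [show x u = 0 from hu, mul_zero]
    · by_cases hy : G.Adj u y
      · rw [show x y = 0 from h y hy hyw, mul_zero]
      · rw [not_not.mp (mt (hM u y hyu).mp hy), zero_mul]
  · simp

/-- A kernel vector vanishing on a zero forcing set is zero, so restriction to that set is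
injective. An arbitrary source `E` allows an explicit family of kernel vectors, without computing
the whole kernel. -/
theorem finrank_le_zeroForcingNumber {W : Type*} [Fintype W] {G : SimpleGraph W}
    {M : Matrix W W ℝ} (hM : ∀ u w, u ≠ w → (M u w ≠ 0 ↔ G.Adj u w))
    {E : Type*} [AddCommGroup E] [Module ℝ E] (φ : E →ₗ[ℝ] (W → ℝ))
    (hφ : Function.Injective φ) (hker : ∀ e, M.mulVec (φ e) = 0) :
    Module.finrank ℝ E ≤ zeroForcingNumber G := by
  refine le_zeroForcingNumber fun S hS => ?_
  have hinj : Function.Injective (LinearMap.funLeft ℝ ℝ (fun s : S => (s : W)) ∘ₗ φ) := by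
    rw [injective_iff_map_eq_zero]
    intro e he
    apply hφ
    rw [map_zero]
    have hT := hS.eq_univ_of_subset (T := {u | φ e u = 0})
      (fun u hu => congrFun he ⟨u, hu⟩) (isForcingClosed_zeros hM (hker e))
    funext u
    exact (Set.ext_iff.mp hT u).mpr trivial
  simpa using LinearMap.finrank_le_finrank_of_injective hinj

theorem finrank_ker_le_zeroForcingNumber {W : Type*} [Fintype W] {G : SimpleGraph W}
    {M : Matrix W W ℝ} (hM : ∀ u w, u ≠ w → (M u w ≠ 0 ↔ G.Adj u w)) :
    Module.finrank ℝ (LinearMap.ker M.mulVecLin) ≤ zeroForcingNumber G :=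
  finrank_le_zeroForcingNumber hM (LinearMap.ker M.mulVecLin).subtype
    (Submodule.subtype_injective _) fun e => e.2

/-- A vector on `r' + 1` copies built from `r'` kernel vectors and a multiple of `z`. -/
def copyMap {V : Type*} (K : Submodule ℝ (V → ℝ)) (z : V → ℝ) (r' : ℕ) :
    ((Fin r' → K) × ℝ) →ₗ[ℝ] (Fin (r' + 1) × V → ℝ) where
  toFun e p := Fin.cases (-∑ i, (e.1 i : V → ℝ) p.2) (fun i => (e.1 i : V → ℝ) p.2) p.1
    + e.2 * z p.2
  map_add' e f := by
    funext ⟨j, v⟩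
    cases j using Fin.cases
    · simp [Finset.sum_add_distrib]; ring
    · simp; ring
  map_smul' c e := by
    funext ⟨j, v⟩
    cases j using Fin.cases
    · simp [← Finset.mul_sum]; ring
    · simp; ring

/-- Copy 0 holds minus the sum of the kernel vectors in the other copies, so only the `z` part
survives summation. -/
theorem sum_copyMap {V : Type*} (K : Submodule ℝ (V → ℝ)) (z : V → ℝ) (r' : ℕ)
    (e : (Fin r' → K) × ℝ) (v : V) :
    ∑ j, copyMap K z r' e (j, v) = ((r' : ℝ) + 1) * (e.2 * z v) := by
  simp [copyMap, Fin.sum_univ_succ, Finset.sum_add_distrib]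

theorem copyMap_injective {V : Type*} (K : Submodule ℝ (V → ℝ)) {z : V → ℝ} (hz : z ≠ 0)
    (r' : ℕ) : Function.Injective (copyMap K z r') := by
  rw [injective_iff_map_eq_zero]
  rintro ⟨y, s⟩ he
  obtain ⟨v, hv⟩ := Function.ne_iff.mp hz
  have hs : s = 0 := by
    have h := sum_copyMap K z r' (y, s) v
    rw [he] at h
    simp only [Pi.zero_apply, Finset.sum_const_zero] at h
    have h1 : ((r' : ℝ) + 1) ≠ 0 := by positivity
    exact (mul_eq_zero.mp ((mul_eq_zero.mp h.symm).resolve_left h1)).resolve_right hv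
  subst hs
  refine Prod.ext (funext fun i => Subtype.ext (funext fun w => ?_)) rfl
  simpa [copyMap] using congrFun he (i.succ, w)

theorem mulVec_copyMap {V : Type*} [Fintype V] {A : Matrix V V ℝ} {z : V → ℝ} {l : ℝ}
    (hz : A.mulVec z = l • z) (r' : ℕ) (e : (Fin r' → LinearMap.ker A.mulVecLin) × ℝ)
    (j : Fin (r' + 1)) (v : V) :
    ∑ w, A v w * copyMap _ z r' e (j, w) = l * (e.2 * z v) := by
  have h1 : ∑ w, A v w * z w = l * z v := congrFun hz v
  have h2 : ∀ i, ∑ w, A v w * (e.1 i : V → ℝ) w = 0 := fun i => congrFun (e.1 i).2 v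
  have h3 : ∑ w, A v w * (e.2 * z w) = l * (e.2 * z v) := by
    simp_rw [mul_left_comm _ e.2, ← Finset.mul_sum, h1]
  cases j using Fin.cases
  · simp only [copyMap, LinearMap.coe_mk, AddHom.coe_mk, Fin.cases_zero, mul_add,
      Finset.sum_add_distrib, h3, mul_neg, Finset.mul_sum, Finset.sum_neg_distrib]
    rw [Finset.sum_comm]
    simp [h2]
  · simp only [copyMap, LinearMap.coe_mk, AddHom.coe_mk, Fin.cases_succ, mul_add,
      Finset.sum_add_distrib, h3, h2, zero_add]

theorem mul_finrank_ker_add_one_le {V : Type*} [Fintype V] {G : SimpleGraph V}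
    {A : Matrix V V ℝ} (hA : ∀ u w, u ≠ w → (A u w ≠ 0 ↔ G.Adj u w)) (hsymm : A.IsHermitian)
    (hne : A ≠ 0) (r : ℕ) (hr : 2 ≤ r) :
    (r - 1) * Module.finrank ℝ (LinearMap.ker A.mulVecLin) + 1 ≤
      zeroForcingNumber ((completeGraph (Fin r)).boxProd G) := by
  classical
  obtain ⟨r', rfl⟩ : ∃ r', r = r' + 1 := ⟨r - 1, by omega⟩
  -- The eigenvalue must be nonzero so that `t` is nonzero and `M` has entries on the edges between
  -- copies.
  obtain ⟨z, l, hl, hz, hAz⟩ := hsymm.exists_eigenvector_of_ne_zero hne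
  have hr0 : ((r' : ℝ) + 1) ≠ 0 := by positivity
  -- On the constant family `z`, `M` acts as `(r' + 1) t + l`, which this choice makes zero.
  set t : ℝ := -l / (r' + 1) with ht
  have ht0 : t ≠ 0 := div_ne_zero (neg_ne_zero.mpr hl) hr0
  let M : Matrix (Fin (r' + 1) × V) (Fin (r' + 1) × V) ℝ := fun p q =>
    (if p.2 = q.2 then t else 0) + (if p.1 = q.1 then A p.2 q.2 else 0)
  have hM : ∀ p q, p ≠ q →
      (M p q ≠ 0 ↔ ((completeGraph (Fin (r' + 1))).boxProd G).Adj p q) := by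
    rintro ⟨j, v⟩ ⟨j', w⟩ hpq
    by_cases hv : v = w
    · subst hv
      have hj : j ≠ j' := fun h => hpq (by rw [h])
      simp [M, hj, ht0, boxProd_adj]
    · by_cases hj : j = j' <;> simp [M, hj, hv, boxProd_adj, hA]
  have := finrank_le_zeroForcingNumber hM (copyMap (LinearMap.ker A.mulVecLin) z r')
    (copyMap_injective _ hz r') ?_
  · simpa [Module.finrank_prod, Module.finrank_pi_fintype] using this
  · intro e
    funext ⟨j, v⟩
    change ∑ q : Fin (r' + 1) × V, M (j, v) q * _ = 0
    have h1 : ∑ q : Fin (r' + 1) × V, M (j, v) q * copyMap _ z r' e q =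
        t * ∑ j', copyMap _ z r' e (j', v) + ∑ w, A v w * copyMap _ z r' e (j, w) := by
      simp only [M, add_mul, Finset.sum_add_distrib, ite_mul, zero_mul]
      congr 1
      · rw [Fintype.sum_prod_type, Finset.mul_sum]
        simp
      · rw [Fintype.sum_prod_type_right]
        simp
    rw [h1, sum_copyMap, mulVec_copyMap hAz, ht]
    field_simp
    ring

/-! ### Complete graphs -/

theorem zeroForcingNumber_completeGraph (r : ℕ) (hr : 2 ≤ r) :
    zeroForcingNumber (completeGraph (Fin r)) = r - 1 := by
  classical
  have hr0 : 0 < r := by omega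
  let p : Fin r := ⟨0, by omega⟩
  apply le_antisymm
  · have hcard : (Finset.univ.erase p).card = r - 1 := by simp
    rw [← hcard]
    refine zeroForcingNumber_le _ fun T hS hT => ?_
    have h : ∀ x, x ≠ p → x ∈ T := fun x hx => hS x (by simp [hx])
    refine Set.eq_univ_of_forall fun x => ?_
    by_cases hx : x = p
    · subst hx
      have h1 : (⟨1, by omega⟩ : Fin r) ≠ p := by simp [p]
      exact hT _ (h _ h1) _ h1 fun y _ hy => h y hy
    · exact h x hx
  · refine le_zeroForcingNumber fun S hS => ?_
    by_contra hlt
    -- With two unfilled vertices, every filled vertex sees both and no force is possible.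
    have hc : 1 < Sᶜ.card := by rw [Finset.card_compl, Fintype.card_fin]; omega
    obtain ⟨a, ha, b, hb, hab⟩ := Finset.one_lt_card.mp hc
    rw [Finset.mem_compl] at ha hb
    have hcl : IsForcingClosed (completeGraph (Fin r)) (S : Set (Fin r)) := by
      intro u hu w _ hx
      have hau : u ≠ a := fun h => ha (by simpa [← h] using hu)
      have hbu : u ≠ b := fun h => hb (by simpa [← h] using hu)
      by_cases haw : a = w
      · exact absurd (hx b hbu fun h => hab (haw.trans h.symm)) (by simpa using hb)
      · exact absurd (hx a hau haw) (by simpa using ha)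
    have := hS.eq_univ_of_subset subset_rfl hcl
    exact ha (by simpa using (Set.ext_iff.mp this a).mpr trivial)

/-! ### Subadditivity of rank -/

theorem Matrix.rank_add_le_add {n : Type*} [Fintype n] (A B : Matrix n n ℝ) :
    (A + B).rank ≤ A.rank + B.rank := by
  unfold Matrix.rank
  rw [Matrix.mulVecLin_add]
  exact (Submodule.finrank_mono (LinearMap.range_add_le _ _)).trans
    (Submodule.finrank_add_le_finrank_add_finrank _ _)

theorem Matrix.rank_sum_le_sum {n ι : Type*} [Fintype n] (s : Finset ι)
    (A : ι → Matrix n n ℝ) : (∑ i ∈ s, A i).rank ≤ ∑ i ∈ s, (A i).rank := by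
  classical
  induction s using Finset.induction_on with
  | empty => simp
  | insert i s hi ih =>
    rw [Finset.sum_insert hi, Finset.sum_insert hi]
    exact (Matrix.rank_add_le_add _ _).trans (by gcongr)

/-! ### Forcing in the product -/

section BoxProd

variable {V : Type*} {G : SimpleGraph V} {r' : ℕ} {T : Set (Fin (r' + 1) × V)}

/-- Once `u` is filled in all copies, its neighbors outside copy `j` are no obstacle, so it forces
there as in `G`. -/
theorem IsForcingClosed.mem_of_adj (hT : IsForcingClosed ((completeGraph (Fin (r' + 1))).boxProd G) T)
    {u w : V} (j : Fin (r' + 1)) (hu : ∀ i, (i, u) ∈ T) (huw : G.Adj u w)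
    (h : ∀ y, G.Adj u y → y ≠ w → (j, y) ∈ T) : (j, w) ∈ T := by
  refine hT (j, u) (hu j) (j, w) (by simpa [boxProd_adj] using huw) ?_
  rintro ⟨i, y⟩ hy hne
  rcases boxProd_adj.mp hy with ⟨-, rfl⟩ | ⟨hy, rfl⟩
  · exact hu i
  · exact h y hy fun hyw => hne (by rw [hyw])

/-- A force between copies: `u` in a nonzero copy forces `u` in copy 0. -/
theorem IsForcingClosed.zero_mem (hT : IsForcingClosed ((completeGraph (Fin (r' + 1))).boxProd G) T)
    {u : V} (hr : 1 ≤ r') (hu : ∀ i, i ≠ 0 → (i, u) ∈ T)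
    (h : ∀ i, i ≠ 0 → ∀ y, G.Adj u y → (i, y) ∈ T) : (0, u) ∈ T := by
  have h1 : Fin.last r' ≠ 0 := by
    intro h
    have := congrArg Fin.val h
    simp at this
    omega
  refine hT (Fin.last r', u) (hu _ h1) (0, u) (by simpa [boxProd_adj] using h1) ?_
  rintro ⟨i, y⟩ hy hne
  rcases boxProd_adj.mp hy with ⟨-, hy⟩ | ⟨hy, hi⟩
  · have hy : u = y := hy
    subst hy
    exact hu i fun h => hne (by rw [h])
  · have hi : Fin.last r' = i := hi
    subst hi
    exact h _ h1 y hy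

/-- If all copies but one of `P` are filled, the last copy gets filled through `u`. -/
theorem IsForcingClosed.fill_last_copy
    (hT : IsForcingClosed ((completeGraph (Fin (r' + 1))).boxProd G) T)
    {P : Finset V} {U : Set V} {a b u : V} (hr : 1 ≤ r')
    (hU : ∀ i, ∀ x ∈ U, (i, x) ∈ T) (ha : ∀ i, (i, a) ∈ T) (hu : ∀ i, (i, u) ∈ T)
    (hub : G.Adj u b) (huy : ∀ y, G.Adj u y → y ∈ P ∨ y ∈ U)
    (hx : ∀ x ∈ P, x ≠ a → x ≠ b → ∀ y, G.Adj x y → y ∈ P)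
    (hP : ∀ i, i ≠ 0 → ∀ x ∈ P, (i, x) ∈ T) (i : Fin (r' + 1)) (x : V) (hxP : x ∈ P) :
    (i, x) ∈ T := by
  have h0 : ∀ x ∈ P, x ≠ b → (0, x) ∈ T := by
    intro x hxP hxb
    by_cases hxa : x = a
    · exact hxa ▸ ha 0
    · exact hT.zero_mem hr (fun i hi => hP i hi x hxP)
        fun i hi y hy => hP i hi y (hx x hxP hxa hxb y hy)
  by_cases hi : i = 0
  · subst hi
    by_cases hxb : x = b
    · subst hxb
      -- The exit `b` may have unfilled neighbors in later pieces, so it cannot be reached from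
      -- another copy; `u` forces it inside copy 0.
      refine hT.mem_of_adj 0 hu hub fun y hy hyx => ?_
      rcases huy y hy with h | h
      · exact h0 y h hyx
      · exact hU 0 y h
    · exact h0 x hxP hxb
  · exact hP i hi x hxP

end BoxProd

/-! ### Forcing sets and matrices for the individual pieces -/

/-- A piece with vertex set `P` and adjacency relation `R`, entered at the vertex `a` when the
vertices of `U` are already filled: filling the vertices of `S` in addition is enough to fill `P`,
in `G` and (in all copies but one) in the product with a complete graph, and the matrix `A`
certifies that this is optimal. -/
structure IsForcingPiece {V : Type*} [Fintype V] (G : SimpleGraph V) (r' : ℕ) (U : Set V)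
    (P : Finset V) (R : V → V → Prop) (a : V) (S : Finset V) (A : Matrix V V ℝ) : Prop where
  symm : A.IsHermitian
  -- Excludes cancellation when the matrices of the pieces are added.
  nonneg : ∀ u w, 0 ≤ A u w
  pattern : ∀ u w, u ≠ w → (A u w ≠ 0 ↔ R u w)
  rank_le : A.rank + S.card + 1 ≤ P.card
  fill : ∀ T : Set V, IsForcingClosed G T → (∀ x ∈ U, x ∈ T) → a ∈ T → (∀ x ∈ S, x ∈ T) →
    ∀ x ∈ P, x ∈ T
  fill_prod : ∀ T : Set (Fin (r' + 1) × V),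
    IsForcingClosed ((completeGraph (Fin (r' + 1))).boxProd G) T →
    (∀ i, ∀ x ∈ U, (i, x) ∈ T) → (∀ i, (i, a) ∈ T) → (∀ i, i ≠ 0 → ∀ x ∈ S, (i, x) ∈ T) →
    ∀ i, ∀ x ∈ P, (i, x) ∈ T

section Pieces

variable {V : Type*} [Fintype V] {G : SimpleGraph V} {r' : ℕ} {U : Set V} {P : Finset V}
  {R : V → V → Prop} {a b c : V}

theorem isForcingPiece_singleton (hR : ∀ x y, ¬ R x y) :
    IsForcingPiece G r' U {a} R a ∅ 0 where
  symm := Matrix.isHermitian_zero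
  nonneg _ _ := le_rfl
  pattern u w _ := by simp [hR]
  rank_le := by simp
  fill T _ _ ha _ x hx := by rwa [Finset.mem_singleton.mp hx]
  fill_prod T _ _ ha _ i x hx := by
    rw [Finset.mem_singleton.mp hx]
    exact ha i

/-- The all-ones matrix on `P` has rank at most 1, and `a` forces the one missing vertex `b`, the
exit. -/
theorem exists_isForcingPiece_clique (hr : 1 ≤ r') (haP : a ∈ P) (hbP : b ∈ P) (hab : a ≠ b)
    (hR : ∀ x y, R x y ↔ x ∈ P ∧ y ∈ P ∧ x ≠ y) (hRG : ∀ x y, R x y → G.Adj x y)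
    (haU : ∀ y, G.Adj a y → y ∈ P ∨ y ∈ U)
    (hx : ∀ x ∈ P, x ≠ a → x ≠ b → ∀ y, G.Adj x y → y ∈ P) :
    ∃ S A, IsForcingPiece G r' U P R a S A := by
  classical
  have hadj : G.Adj a b := hRG a b ((hR a b).mpr ⟨haP, hbP, hab⟩)
  have hS : ∀ x ∈ P, x ≠ a → x ≠ b → x ∈ (P.erase a).erase b := fun x h1 h2 h3 => by
    simp [h1, h2, h3]
  refine ⟨(P.erase a).erase b,
    Matrix.vecMulVec (fun x => if x ∈ P then 1 else 0) (fun x => if x ∈ P then 1 else 0),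
    ⟨?_, ?_, ?_, ?_, ?_, ?_⟩⟩
  · ext u w
    simp [Matrix.vecMulVec_apply, mul_comm]
  · intro u w
    rw [Matrix.vecMulVec_apply]
    positivity
  · intro u w huw
    simp [Matrix.vecMulVec_apply, hR, huw, and_comm]
  · have h1 := Matrix.rank_vecMulVec_le (R := ℝ) (fun x => if x ∈ P then 1 else 0)
      (fun x => if x ∈ P then 1 else 0)
    have h2 := Finset.card_erase_add_one haP
    have h3 := Finset.card_erase_add_one (Finset.mem_erase.mpr ⟨hab.symm, hbP⟩)
    omega
  · intro T hT hU ha hST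
    have h1 : ∀ x ∈ P, x ≠ b → x ∈ T := fun x hxP hxb => by
      by_cases hxa : x = a
      · rwa [hxa]
      · exact hST x (hS x hxP hxa hxb)
    intro x hxP
    by_cases hxb : x = b
    · subst hxb
      exact hT a ha _ hadj fun y hy hyx => (haU y hy).elim (fun h => h1 y h hyx) (hU y)
    · exact h1 x hxP hxb
  · intro T hT hU ha hST
    have h1 : ∀ i, i ≠ 0 → ∀ x ∈ P, x ≠ b → (i, x) ∈ T := fun i hi x hxP hxb => by
      by_cases hxa : x = a
      · rw [hxa]
        exact ha i
      · exact hST i hi x (hS x hxP hxa hxb)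
    refine hT.fill_last_copy hr hU ha ha hadj haU hx fun i hi x hxP => ?_
    by_cases hxb : x = b
    · subst hxb
      exact hT.mem_of_adj i ha hadj fun y hy hyx =>
        (haU y hy).elim (fun h => h1 i hi y h hyx) (hU i y)
    · exact h1 i hi x hxP hxb

/-- The star matrix is a sum of two rank-one matrices. The leaf `a` forces the center `c`, which
then forces the leaf `b`, so three vertices are left out of `S`. -/
theorem exists_isForcingPiece_star (hr : 1 ≤ r') (haP : a ∈ P) (hbP : b ∈ P) (hcP : c ∈ P)
    (hab : a ≠ b) (hac : a ≠ c) (hbc : b ≠ c)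
    (hR : ∀ x y, R x y ↔ x ∈ P ∧ y ∈ P ∧ x ≠ y ∧ (x = c ∨ y = c))
    (hRG : ∀ x y, R x y → G.Adj x y) (hGR : ∀ x ∈ P, ∀ y ∈ P, G.Adj x y → R x y)
    (haU : ∀ y, G.Adj a y → y ∈ P ∨ y ∈ U)
    (hx : ∀ x ∈ P, x ≠ a → x ≠ b → ∀ y, G.Adj x y → y ∈ P) :
    ∃ S A, IsForcingPiece G r' U P R a S A := by
  classical
  have hadj : G.Adj a c := hRG a c ((hR a c).mpr ⟨haP, hcP, hac, Or.inr rfl⟩)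
  have hcb : G.Adj c b := hRG c b ((hR c b).mpr ⟨hcP, hbP, hbc.symm, Or.inl rfl⟩)
  have hcU : ∀ y, G.Adj c y → y ∈ P := hx c hcP hac.symm hbc.symm
  have haU' : ∀ y, G.Adj a y → y ≠ c → y ∈ U := fun y hy hyc => by
    rcases haU y hy with h | h
    · rcases ((hR a y).mp (hGR a haP y h hy)).2.2.2 with h | h
      · exact absurd h hac
      · exact absurd h hyc
    · exact h
  have hS : ∀ x ∈ P, x ≠ a → x ≠ b → x ≠ c → x ∈ ((P.erase a).erase b).erase c :=
    fun x h1 h2 h3 h4 => by simp [h1, h2, h3, h4]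
  refine ⟨((P.erase a).erase b).erase c,
    Matrix.vecMulVec (fun x => if x = c then 1 else 0) (fun x => if x ∈ P.erase c then 1 else 0) +
    Matrix.vecMulVec (fun x => if x ∈ P.erase c then 1 else 0) (fun x => if x = c then 1 else 0),
    ⟨?_, ?_, ?_, ?_, ?_, ?_⟩⟩
  · ext u w
    simp only [Matrix.conjTranspose_apply, Matrix.add_apply, Matrix.vecMulVec_apply, star_trivial]
    ring
  · intro u w
    rw [Matrix.add_apply, Matrix.vecMulVec_apply, Matrix.vecMulVec_apply]
    positivity
  · intro u w huw
    rw [hR, Matrix.add_apply, Matrix.vecMulVec_apply, Matrix.vecMulVec_apply]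
    by_cases hu : u = c
    · subst hu
      simp [hcP, huw, huw.symm]
    · by_cases hw : w = c
      · subst hw
        simp [hcP, huw]
      · simp [hu, hw]
  · have h0 := Matrix.rank_add_le_add
      (Matrix.vecMulVec (fun x => if x = c then (1 : ℝ) else 0)
        (fun x => if x ∈ P.erase c then 1 else 0))
      (Matrix.vecMulVec (fun x => if x ∈ P.erase c then 1 else 0)
        (fun x => if x = c then 1 else 0))
    have h1 := Matrix.rank_vecMulVec_le (R := ℝ) (fun x => if x = c then 1 else 0)
      (fun x => if x ∈ P.erase c then 1 else 0)
    have h1' := Matrix.rank_vecMulVec_le (R := ℝ) (fun x => if x ∈ P.erase c then 1 else 0)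
      (fun x => if x = c then 1 else 0)
    have h2 := Finset.card_erase_add_one haP
    have h3 := Finset.card_erase_add_one (Finset.mem_erase.mpr ⟨hab.symm, hbP⟩)
    have h4 := Finset.card_erase_add_one
      (Finset.mem_erase.mpr ⟨hbc.symm, Finset.mem_erase.mpr ⟨hac.symm, hcP⟩⟩)
    omega
  · intro T hT hU ha hST
    have hc : c ∈ T := hT a ha c hadj fun y hy hyc => hU y (haU' y hy hyc)
    have h1 : ∀ x ∈ P, x ≠ b → x ∈ T := fun x hxP hxb => by
      by_cases hxa : x = a
      · rwa [hxa]
      · by_cases hxc : x = c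
        · rwa [hxc]
        · exact hST x (hS x hxP hxa hxb hxc)
    intro x hxP
    by_cases hxb : x = b
    · subst hxb
      exact hT c hc _ hcb fun y hy hyx => h1 y (hcU y hy) hyx
    · exact h1 x hxP hxb
  · intro T hT hU ha hST
    have hc : ∀ i, (i, c) ∈ T := fun i =>
      hT.mem_of_adj i ha hadj fun y hy hyc => hU i y (haU' y hy hyc)
    have h1 : ∀ i, i ≠ 0 → ∀ x ∈ P, x ≠ b → (i, x) ∈ T := fun i hi x hxP hxb => by
      by_cases hxa : x = a
      · rw [hxa]
        exact ha i
      · by_cases hxc : x = c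
        · rw [hxc]
          exact hc i
        · exact hST i hi x (hS x hxP hxa hxb hxc)
    refine hT.fill_last_copy hr hU ha hc hcb (fun y hy => Or.inl (hcU y hy)) hx
      fun i hi x hxP => ?_
    by_cases hxb : x = b
    · subst hxb
      exact hT.mem_of_adj i hc hcb fun y hy hyx => h1 i hi y (hcU y hy) hyx
    · exact h1 i hi x hxP hxb

end Pieces

/-! ### Structure of star-clique paths -/

theorem IsCliqueGraph.coe_adj_iff {V : Type*} {G : SimpleGraph V} {H : G.Subgraph}
    (hH : IsCliqueGraph H.coe) (x y : V) :
    H.Adj x y ↔ x ∈ H.verts ∧ y ∈ H.verts ∧ x ≠ y := by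
  refine ⟨fun h => ⟨h.fst_mem, h.snd_mem, h.ne⟩, fun ⟨hx, hy, hxy⟩ => ?_⟩
  have h : H.coe.Adj ⟨x, hx⟩ ⟨y, hy⟩ := by
    rw [hH.2, top_adj]
    exact fun h => hxy (congrArg Subtype.val h)
  exact h

theorem IsStarGraph.exists_coe_adj_iff {V : Type*} {G : SimpleGraph V} {H : G.Subgraph}
    (hH : IsStarGraph H.coe) : H.verts.Nontrivial ∧
      ∃ c ∈ H.verts, ∀ x y, H.Adj x y ↔ x ∈ H.verts ∧ y ∈ H.verts ∧ x ≠ y ∧ (x = c ∨ y = c) := by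
  obtain ⟨hn, ⟨c, hc⟩, h⟩ := hH
  have key : ∀ x (hx : x ∈ H.verts) y (hy : y ∈ H.verts),
      H.Adj x y ↔ x ≠ y ∧ (x = c ∨ y = c) := fun x hx y hy => by
    rw [← Subgraph.coe_adj H ⟨x, hx⟩ ⟨y, hy⟩, h, starGraph_adj]
    simp
  exact ⟨Set.nontrivial_coe_sort.mp hn, c, hc, fun x y =>
    ⟨fun h => ⟨h.fst_mem, h.snd_mem, (key x h.fst_mem y h.snd_mem).mp h⟩,
      fun ⟨hx, hy, hxy⟩ => (key x hx y hy).mpr hxy⟩⟩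

/-- Chooses distinct entry and exit vertices; an end piece lacks a prescribed entry or exit, and
then any other vertex serves. -/
theorem exists_ne_with_prescribed {V : Type*} {Q : Set V} (hQ : Q.Nontrivial) {p q : Prop}
    {x y : V} (hx : p → x ∈ Q) (hy : q → y ∈ Q) (hxy : p → q → x ≠ y) :
    ∃ a ∈ Q, ∃ b ∈ Q, a ≠ b ∧ (p → a = x) ∧ (q → b = y) := by
  by_cases hp : p
  · by_cases hq : q
    · exact ⟨x, hx hp, y, hy hq, hxy hp hq, fun _ => rfl, fun _ => rfl⟩
    · obtain ⟨b, hb, hbx⟩ := hQ.exists_ne x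
      exact ⟨x, hx hp, b, hb, hbx.symm, fun _ => rfl, fun h => absurd h hq⟩
  · by_cases hq : q
    · obtain ⟨a, ha, hay⟩ := hQ.exists_ne y
      exact ⟨a, ha, y, hy hq, hay, fun h => absurd h hp, fun _ => rfl⟩
    · obtain ⟨a, ha, b, hb, hab⟩ := hQ
      exact ⟨a, ha, b, hb, hab, fun h => absurd h hp, fun h => absurd h hq⟩

namespace IsStarCliquePathOf

variable {V : Type*} {G : SimpleGraph V} {k : ℕ} {H : ℕ → G.Subgraph} {v : ℕ → V}

theorem adj_iff (h : IsStarCliquePathOf G k H v) (x y : V) :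
    G.Adj x y ↔ ∃ i, 1 ≤ i ∧ i ≤ k ∧ (H i).Adj x y := by
  rw [← Subgraph.top_adj (G := G), ← h.union_eq]
  simp [Subgraph.iSup_adj, and_assoc]

theorem exists_mem_verts (h : IsStarCliquePathOf G k H v) (x : V) :
    ∃ i, 1 ≤ i ∧ i ≤ k ∧ x ∈ (H i).verts := by
  have hx : x ∈ (⊤ : G.Subgraph).verts := trivial
  rw [← h.union_eq] at hx
  simpa [Subgraph.verts_iSup, and_assoc] using hx

theorem eq_cut_of_mem_of_mem (h : IsStarCliquePathOf G k H v) {i j : ℕ} (hi : 1 ≤ i) (hij : i < j)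
    (hj : j ≤ k) {x : V} (hxi : x ∈ (H i).verts) (hxj : x ∈ (H j).verts) :
    j = i + 1 ∧ x = v j := by
  have hji : j = i + 1 := by
    by_contra hne
    have := h.inter_far j i hj hi (by omega)
    exact (this ▸ (⟨hxi, hxj⟩ : x ∈ (H i).verts ∩ (H j).verts) : x ∈ (∅ : Set V))
  refine ⟨hji, ?_⟩
  have := h.inter_consecutive j (by omega) hj
  rw [show j - 1 = i by omega] at this
  exact (this ▸ (⟨hxi, hxj⟩ : x ∈ (H i).verts ∩ (H j).verts) : x ∈ ({v j} : Set V))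

theorem cut_mem (h : IsStarCliquePathOf G k H v) {i : ℕ} (hi : 2 ≤ i) (hik : i ≤ k) :
    v i ∈ (H (i - 1)).verts ∧ v i ∈ (H i).verts := by
  have : v i ∈ ({v i} : Set V) := rfl
  rwa [← h.inter_consecutive i hi hik] at this

theorem eq_of_mem_of_mem (h : IsStarCliquePathOf G k H v) {i j : ℕ} (hi : 1 ≤ i) (hik : i ≤ k)
    (hj : 1 ≤ j) (hjk : j ≤ k) (hij : i ≠ j) {x y : V} (hxi : x ∈ (H i).verts)
    (hxj : x ∈ (H j).verts) (hyi : y ∈ (H i).verts) (hyj : y ∈ (H j).verts) : x = y := by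
  rcases lt_or_gt_of_ne hij with hlt | hlt
  · rw [(h.eq_cut_of_mem_of_mem hi hlt hjk hxi hxj).2, (h.eq_cut_of_mem_of_mem hi hlt hjk hyi hyj).2]
  · rw [(h.eq_cut_of_mem_of_mem hj hlt hik hxj hxi).2, (h.eq_cut_of_mem_of_mem hj hlt hik hyj hyi).2]

/-- A vertex other than the exit of a piece has its neighbors in this and in earlier pieces. -/
theorem exists_le_mem_of_adj (h : IsStarCliquePathOf G k H v) {i : ℕ} (hi : 1 ≤ i) {x : V}
    (hx : x ∈ (H i).verts) (hxv : i < k → x ≠ v (i + 1)) {y : V} (hxy : G.Adj x y) :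
    ∃ j, 1 ≤ j ∧ j ≤ i ∧ y ∈ (H j).verts := by
  obtain ⟨j, hj, hjk, hadj⟩ := (h.adj_iff x y).mp hxy
  refine ⟨j, hj, ?_, hadj.snd_mem⟩
  by_contra hlt
  obtain ⟨rfl, hxj⟩ := h.eq_cut_of_mem_of_mem hi (not_le.mp hlt) hjk hx hadj.fst_mem
  exact hxv (by omega) hxj

/-- A vertex other than the entry and the exit of a piece has its neighbors in this piece. -/
theorem mem_of_adj (h : IsStarCliquePathOf G k H v) {i : ℕ} (hi : 1 ≤ i) (hik : i ≤ k) {x : V}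
    (hx : x ∈ (H i).verts) (hxv : i < k → x ≠ v (i + 1)) (hxv' : 2 ≤ i → x ≠ v i) {y : V}
    (hxy : G.Adj x y) : y ∈ (H i).verts := by
  obtain ⟨j, hj, hjk, hadj⟩ := (h.adj_iff x y).mp hxy
  rcases lt_trichotomy i j with hlt | rfl | hlt
  · obtain ⟨rfl, hxj⟩ := h.eq_cut_of_mem_of_mem hi hlt hjk hx hadj.fst_mem
    exact absurd hxj (hxv (by omega))
  · exact hadj.snd_mem
  · exact absurd (h.eq_cut_of_mem_of_mem hj hlt hik hadj.fst_mem hx).2 (hxv' (by omega))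

theorem hasDegreeOne (h : IsStarCliquePathOf G k H v) {i : ℕ} (hi : 1 ≤ i) (hik : i ≤ k)
    (hs : IsStarGraph (H i).coe) :
    (2 ≤ i → HasDegreeOne (H i) (v i)) ∧ (i < k → HasDegreeOne (H i) (v (i + 1))) := by
  constructor
  · intro h2
    rcases hik.lt_or_eq with hlt | rfl
    · exact (h.star_middle i h2 hlt hs).1
    · exact h.star_last h2 hs
  · intro hlt
    rcases hi.lt_or_eq with h1 | rfl
    · exact (h.star_middle i h1 hlt hs).2
    · exact h.star_first hlt hs

theorem exists_isForcingPiece [Fintype V] (h : IsStarCliquePathOf G k H v) {r' : ℕ} (hr : 1 ≤ r')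
    {P : ℕ → Finset V} (hP : ∀ i x, x ∈ P i ↔ x ∈ (H i).verts) {i : ℕ} (hi : 1 ≤ i)
    (hik : i ≤ k) :
    ∃ a S A, (2 ≤ i → a = v i) ∧
      IsForcingPiece G r' {x | ∃ j, 1 ≤ j ∧ j < i ∧ x ∈ P j} (P i) (H i).Adj a S A := by
  have hv : 2 ≤ i → v i ∈ (H i).verts := fun h2 => (h.cut_mem h2 hik).2
  have hv' : i < k → v (i + 1) ∈ (H i).verts := fun hlt =>
    (h.cut_mem (i := i + 1) (by omega) hlt).1
  have hne : 2 ≤ i → i < k → v i ≠ v (i + 1) := fun h2 hlt =>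
    (h.cut_ne (i + 1) i hlt h2 (by omega)).symm
  have haU : ∀ a b, a ∈ (H i).verts → a ≠ b → (i < k → b = v (i + 1)) → ∀ y, G.Adj a y →
      y ∈ P i ∨ y ∈ {x | ∃ j, 1 ≤ j ∧ j < i ∧ x ∈ P j} := by
    intro a b ha hab hb y hy
    obtain ⟨j, hj, hji, hyj⟩ := h.exists_le_mem_of_adj hi ha (fun hlt => hb hlt ▸ hab) hy
    rcases hji.lt_or_eq with hlt | rfl
    · exact Or.inr ⟨j, hj, hlt, (hP j y).mpr hyj⟩
    · exact Or.inl ((hP j y).mpr hyj)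
  have hxP : ∀ a b, (2 ≤ i → a = v i) → (i < k → b = v (i + 1)) → ∀ x ∈ P i, x ≠ a → x ≠ b →
      ∀ y, G.Adj x y → y ∈ P i := by
    intro a b ha hb x hx hxa hxb y hy
    exact (hP i y).mpr (h.mem_of_adj hi hik ((hP i x).mp hx) (fun hlt => hb hlt ▸ hxb)
      (fun h2 => ha h2 ▸ hxa) hy)
  have hRG : ∀ x y, (H i).Adj x y → G.Adj x y := fun x y hxy => hxy.adj_sub
  have clique : (H i).verts.Nonempty →
      (∀ x y, (H i).Adj x y ↔ x ∈ (H i).verts ∧ y ∈ (H i).verts ∧ x ≠ y) →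
      ∃ a S A, (2 ≤ i → a = v i) ∧
        IsForcingPiece G r' {x | ∃ j, 1 ≤ j ∧ j < i ∧ x ∈ P j} (P i) (H i).Adj a S A := by
    rintro ⟨x, hx⟩ hadj
    by_cases hnt : (H i).verts.Nontrivial
    · obtain ⟨a, ha, b, hb, hab, hav, hbv⟩ := exists_ne_with_prescribed hnt hv hv' hne
      obtain ⟨S, A, hSA⟩ := exists_isForcingPiece_clique hr ((hP i a).mpr ha) ((hP i b).mpr hb) hab
        (fun x y => by rw [hadj, hP, hP]) hRG (haU a b ha hab hbv) (hxP a b hav hbv)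
      exact ⟨a, S, A, hav, hSA⟩
    · rw [Set.not_nontrivial_iff] at hnt
      have hPi : P i = {x} := by
        ext y
        rw [hP, Finset.mem_singleton]
        exact ⟨fun hy => hnt hy hx, fun hy => hy ▸ hx⟩
      rw [hPi]
      exact ⟨x, ∅, 0, fun h2 => hnt hx (hv h2), isForcingPiece_singleton fun y z hyz =>
        hyz.ne (hnt hyz.fst_mem hyz.snd_mem)⟩
  rcases h.star_or_clique i hi hik with hs | hc
  · obtain ⟨hnt, c, hc, hadj⟩ := hs.exists_coe_adj_iff
    -- A star with a single leaf is `K_2` and is treated as a clique: its center may be a cut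
    -- vertex, and it has no second leaf.
    by_cases hL : ((H i).verts \ {c}).Nontrivial
    · have hdeg : ∀ w, w ∈ (H i).verts → HasDegreeOne (H i) w → w ∈ (H i).verts \ {c} := by
        rintro w hw hdeg
        refine ⟨hw, ?_⟩
        rintro rfl
        obtain ⟨z, hz⟩ := Set.ncard_eq_one.mp hdeg
        have hz' : ∀ y ∈ (H i).verts \ {w}, y = z := fun y hy => by
          have : y ∈ (H i).neighborSet w :=
            (hadj w y).mpr ⟨hw, hy.1, fun h => hy.2 h.symm, Or.inl rfl⟩
          rwa [hz] at this
        obtain ⟨p, hp, q, hq, hpq⟩ := hL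
        exact hpq ((hz' p hp).trans (hz' q hq).symm)
      obtain ⟨a, ha, b, hb, hab, hav, hbv⟩ := exists_ne_with_prescribed hL
        (fun h2 => hdeg _ (hv h2) ((h.hasDegreeOne hi hik hs).1 h2))
        (fun hlt => hdeg _ (hv' hlt) ((h.hasDegreeOne hi hik hs).2 hlt)) hne
      have hGR : ∀ x ∈ P i, ∀ y ∈ P i, G.Adj x y → (H i).Adj x y := fun x hx y hy hxy => by
        obtain ⟨j, hj, hjk, hadj'⟩ := (h.adj_iff x y).mp hxy
        by_cases hij : i = j
        · exact hij ▸ hadj'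
        · exact absurd (h.eq_of_mem_of_mem hi hik hj hjk hij ((hP i x).mp hx) hadj'.fst_mem
            ((hP i y).mp hy) hadj'.snd_mem) hxy.ne
      obtain ⟨S, A, hSA⟩ := exists_isForcingPiece_star hr ((hP i a).mpr ha.1) ((hP i b).mpr hb.1)
        ((hP i c).mpr hc) hab ha.2 hb.2 (fun x y => by rw [hadj, hP, hP]) hRG hGR
        (haU a b ha.1 hab hbv) (hxP a b hav hbv)
      exact ⟨a, S, A, hav, hSA⟩
    · rw [Set.not_nontrivial_iff] at hL
      refine clique hnt.nonempty fun x y => ?_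
      rw [hadj]
      refine ⟨fun ⟨h1, h2, h3, _⟩ => ⟨h1, h2, h3⟩, fun ⟨h1, h2, h3⟩ => ⟨h1, h2, h3, ?_⟩⟩
      by_contra hxy
      rw [not_or] at hxy
      exact h3 (hL ⟨h1, hxy.1⟩ ⟨h2, hxy.2⟩)
  · obtain ⟨⟨x, hx⟩⟩ := hc.1
    exact clique ⟨x, hx⟩ hc.coe_adj_iff

/-- Each new piece meets the union of the earlier ones in at most one vertex. -/
theorem sum_card_add_one_le [DecidableEq V] (h : IsStarCliquePathOf G k H v)
    {P : ℕ → Finset V} (hP : ∀ i x, x ∈ P i ↔ x ∈ (H i).verts) {i : ℕ}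
    (hi : 1 ≤ i) (hik : i ≤ k) :
    ∑ j ∈ Finset.Icc 1 i, (P j).card + 1 ≤ ((Finset.Icc 1 i).biUnion P).card + i := by
  induction i, hi using Nat.le_induction with
  | base => simp
  | succ i hi ih =>
    have hins : Finset.Icc 1 (i + 1) = insert (i + 1) (Finset.Icc 1 i) := by
      ext j
      simp only [Finset.mem_Icc, Finset.mem_insert]
      omega
    have hinter : (P (i + 1) ∩ (Finset.Icc 1 i).biUnion P).card ≤ 1 := by
      have hcut : ∀ x ∈ P (i + 1) ∩ (Finset.Icc 1 i).biUnion P, x = v (i + 1) := fun x hx => by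
        obtain ⟨hx, hx'⟩ := Finset.mem_inter.mp hx
        obtain ⟨j, hj, hxj⟩ := Finset.mem_biUnion.mp hx'
        obtain ⟨hj1, hji⟩ := Finset.mem_Icc.mp hj
        exact (h.eq_cut_of_mem_of_mem hj1 (by omega) hik ((hP j x).mp hxj) ((hP _ x).mp hx)).2
      exact Finset.card_le_one.mpr fun x hx y hy => (hcut x hx).trans (hcut y hy).symm
    have hcard := Finset.card_union_add_card_inter (P (i + 1)) ((Finset.Icc 1 i).biUnion P)
    have ih := ih (by omega)
    rw [hins, Finset.sum_insert (by simp), Finset.biUnion_insert]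
    omega

end IsStarCliquePathOf

/-! ### Assembling the pieces -/

theorem Matrix.pattern_sum {V : Type*} {s : Finset ℕ} {A : ℕ → Matrix V V ℝ} {R : ℕ → V → V → Prop}
    (h0 : ∀ i ∈ s, ∀ u w, 0 ≤ A i u w) (hA : ∀ i ∈ s, ∀ u w, u ≠ w → (A i u w ≠ 0 ↔ R i u w))
    (u w : V) (huw : u ≠ w) : (∑ i ∈ s, A i) u w ≠ 0 ↔ ∃ i ∈ s, R i u w := by
  rw [Matrix.sum_apply, Ne, Finset.sum_eq_zero_iff_of_nonneg fun i hi => h0 i hi u w]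
  push Not
  exact exists_congr fun i => and_congr_right fun hi => hA i hi u w huw

theorem mainTheorem2 {V : Type*} [Fintype V] (G : SimpleGraph V) (hG : IsStarCliquePath G)
    (hedge : ∃ u w : V, G.Adj u w) (r : ℕ) (hr : 2 ≤ r) :
    zeroForcingNumber ((completeGraph (Fin r)).boxProd G) = (r - 1) * zeroForcingNumber G + 1 ∧
    zeroForcingNumber ((completeGraph (Fin r)).boxProd G) =
      zeroForcingNumber (completeGraph (Fin r)) * zeroForcingNumber G + 1 := by
  classical
  rw [zeroForcingNumber_completeGraph r hr, and_self]
  obtain ⟨k, H, v, h⟩ := hG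
  obtain ⟨r', rfl⟩ : ∃ r', r = r' + 1 := ⟨r - 1, by omega⟩
  obtain ⟨P, hP⟩ : ∃ P : ℕ → Finset V, ∀ i x, x ∈ P i ↔ x ∈ (H i).verts :=
    ⟨fun i => (H i).verts.toFinset, fun i x => by simp⟩
  have hex : ∀ i, ∃ a S A, 1 ≤ i ∧ i ≤ k → (2 ≤ i → a = v i) ∧
      IsForcingPiece G r' {x | ∃ j, 1 ≤ j ∧ j < i ∧ x ∈ P j} (P i) (H i).Adj a S A := by
    intro i
    by_cases hi : 1 ≤ i ∧ i ≤ k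
    · obtain ⟨a, S, A, hSA⟩ := h.exists_isForcingPiece (r' := r') (by omega) hP hi.1 hi.2
      exact ⟨a, S, A, fun _ => hSA⟩
    -- Arbitrary values outside the index range, so that `choose` gives total functions.
    · exact ⟨hedge.choose, ∅, 0, fun h => absurd h hi⟩
  choose a S A hpiece using hex
  have hk := h.one_le
  set B : Matrix V V ℝ := ∑ i ∈ Finset.Icc 1 k, A i with hB
  set N := ∑ i ∈ Finset.Icc 1 k, (S i).card with hN
  have hmem : ∀ i ∈ Finset.Icc 1 k, 1 ≤ i ∧ i ≤ k := fun i hi => Finset.mem_Icc.mp hi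
  have hpat : ∀ u w, u ≠ w → (B u w ≠ 0 ↔ G.Adj u w) := fun u w huw => by
    rw [hB, Matrix.pattern_sum (fun i hi => (hpiece i (hmem i hi)).2.nonneg)
      (fun i hi => (hpiece i (hmem i hi)).2.pattern) u w huw, h.adj_iff]
    simp [and_assoc]
  have hherm : B.IsHermitian := by
    rw [hB, Matrix.IsHermitian, Matrix.conjTranspose_sum]
    exact Finset.sum_congr rfl fun i hi => (hpiece i (hmem i hi)).2.symm
  have hB0 : B ≠ 0 := by
    obtain ⟨u, w, huw⟩ := hedge
    intro h0
    exact (hpat u w huw.ne).mpr huw (by rw [h0]; rfl)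
  have hker : N + 1 ≤ Module.finrank ℝ (LinearMap.ker B.mulVecLin) := by
    have h1 : B.rank ≤ ∑ i ∈ Finset.Icc 1 k, (A i).rank := Matrix.rank_sum_le_sum _ _
    have h2 : ∑ i ∈ Finset.Icc 1 k, ((A i).rank + (S i).card + 1) ≤
        ∑ i ∈ Finset.Icc 1 k, (P i).card :=
      Finset.sum_le_sum fun i hi => (hpiece i (hmem i hi)).2.rank_le
    have h3 := h.sum_card_add_one_le hP hk le_rfl
    have h4 : ((Finset.Icc 1 k).biUnion P).card ≤ Fintype.card V := Finset.card_le_univ _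
    have h5 : B.rank + Module.finrank ℝ (LinearMap.ker B.mulVecLin) = Fintype.card V := by
      simpa [Matrix.rank] using LinearMap.finrank_range_add_finrank_ker B.mulVecLin
    simp only [Finset.sum_add_distrib, Finset.sum_const, Nat.card_Icc, smul_eq_mul] at h2
    -- From `rank B + N + k ≤ ∑ |P i|` and `∑ |P i| + 1 ≤ |V| + k`.
    omega
  have hG_le : zeroForcingNumber G ≤ N + 1 := by
    refine (zeroForcingNumber_le (insert (a 1) ((Finset.Icc 1 k).biUnion S))
      fun T hST hT => ?_).trans ((Finset.card_insert_le _ _).trans ?_)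
    · have hfill : ∀ i, 1 ≤ i ∧ i ≤ k → ∀ x ∈ P i, x ∈ T := by
        intro i
        induction i using Nat.strong_induction_on with
        | _ i ih =>
          intro hi
          refine (hpiece i hi).2.fill T hT ?_ ?_ ?_
          · rintro x ⟨j, hj, hji, hx⟩
            exact ih j hji ⟨hj, by omega⟩ x hx
          -- The entry of a later piece is a cut vertex, already filled as part of the preceding
          -- piece.
          · rcases hi.1.lt_or_eq with h2 | rfl
            · refine ih (i - 1) (by omega) ⟨by omega, by omega⟩ _ ((hP _ _).mpr ?_)
              rw [(hpiece i hi).1 h2]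
              exact (h.cut_mem h2 hi.2).1
            · exact hST _ (Finset.mem_insert_self _ _)
          · exact fun x hx => hST x (Finset.mem_insert_of_mem
              (Finset.mem_biUnion.mpr ⟨i, Finset.mem_Icc.mpr hi, hx⟩))
      refine Set.eq_univ_of_forall fun x => ?_
      obtain ⟨i, hi, hik, hx⟩ := h.exists_mem_verts x
      exact hfill i ⟨hi, hik⟩ x ((hP i x).mpr hx)
    · exact Nat.add_le_add_right Finset.card_biUnion_le 1
  have hprod_le : zeroForcingNumber ((completeGraph (Fin (r' + 1))).boxProd G) ≤
      r' * (N + 1) + 1 := by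
    refine (zeroForcingNumber_le (Finset.univ ×ˢ {a 1} ∪
      (Finset.univ.erase 0) ×ˢ ((Finset.Icc 1 k).biUnion S))
      fun T hST hT => ?_).trans ((Finset.card_union_le _ _).trans ?_)
    · have hfill : ∀ i, 1 ≤ i ∧ i ≤ k → ∀ l, ∀ x ∈ P i, (l, x) ∈ T := by
        intro i
        induction i using Nat.strong_induction_on with
        | _ i ih =>
          intro hi
          refine (hpiece i hi).2.fill_prod T hT ?_ ?_ ?_
          · rintro l x ⟨j, hj, hji, hx⟩
            exact ih j hji ⟨hj, by omega⟩ l x hx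
          · intro l
            rcases hi.1.lt_or_eq with h2 | rfl
            · refine ih (i - 1) (by omega) ⟨by omega, by omega⟩ l _ ((hP _ _).mpr ?_)
              rw [(hpiece i hi).1 h2]
              exact (h.cut_mem h2 hi.2).1
            · exact hST _ (by simp)
          · intro l hl x hx
            refine hST _ (Finset.mem_union_right _ (Finset.mem_product.mpr ⟨by simp [hl], ?_⟩))
            exact Finset.mem_biUnion.mpr ⟨i, Finset.mem_Icc.mpr hi, hx⟩
      refine Set.eq_univ_of_forall fun ⟨l, x⟩ => ?_
      obtain ⟨i, hi, hik, hx⟩ := h.exists_mem_verts x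
      exact hfill i ⟨hi, hik⟩ l x ((hP i x).mpr hx)
    · have h1 : ((Finset.Icc 1 k).biUnion S).card ≤ N := Finset.card_biUnion_le
      simp only [Finset.card_product, Finset.card_univ, Fintype.card_fin, Finset.card_singleton,
        Finset.card_erase_of_mem (Finset.mem_univ _), Nat.add_sub_cancel]
      nlinarith
  have hG : zeroForcingNumber G = N + 1 :=
    hG_le.antisymm (hker.trans (finrank_ker_le_zeroForcingNumber hpat))
  rw [hG]
  refine hprod_le.antisymm (le_trans ?_ (mul_finrank_ker_add_one_le hpat hherm hB0 _ hr))
  exact Nat.add_le_add_right (Nat.mul_le_mul_left _ hker) 1
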